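/- Let $G$ be a finite non-abelian group with centre $Z(G)$, and let $\Gamma_G$ be the commuting graph of $G$: the simple graph with vertex set $G\setminus Z(G)$ in which two distinct vertices $x$ and $y$ are adjacent if and only if $xy=yx$. If the complement of $\Gamma_G$ (the graph on $G\setminus Z(G)$ in which two distinct vertices are adjacent if and only if they do not commute) is planar, that is, can be drawn in the plane without crossing edges, then $\Gamma_G$ is integral, that is, every eigenvalue of the adjacency matrix of $\Gamma_G$ is an integer. -/

import Mathlib

namespace SimpleGraph

/-- A plane drawing of a graph without crossings: vertices are distinct points of the Euclidean
plane, every edge is a simple arc joining its two ends, and the interior of an edge contains no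
vertex and no point of any other edge. An edge is traversed in its two directions by its two darts;
both describe the same arc. -/
structure PlaneEmbedding {V : Type*} (Γ : SimpleGraph V) where
  point : V → EuclideanSpace ℝ (Fin 2)
  point_injective : Function.Injective point
  arc : (d : Γ.Dart) → _root_.Path (point d.fst) (point d.snd)
  arc_symm : ∀ d : Γ.Dart, arc d.symm = (arc d).symm
  arc_injective : ∀ d : Γ.Dart, Function.Injective (arc d)
  arc_ne_point : ∀ (d : Γ.Dart) (t : unitInterval) (v : V),
    0 < t → t < 1 → arc d t ≠ point v
  arc_ne_arc : ∀ (d d' : Γ.Dart) (t t' : unitInterval), d.edge ≠ d'.edge →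
    0 < t → t < 1 → 0 < t' → t' < 1 → arc d t ≠ arc d' t'

/-- A graph is planar if it can be drawn in the plane without crossings. -/
def IsPlanarGraph {V : Type*} (Γ : SimpleGraph V) : Prop :=
  Nonempty Γ.PlaneEmbedding

open scoped Classical in
/-- The spectrum of a finite graph: the multiset of all eigenvalues of its adjacency matrix
(the complex roots of its characteristic polynomial), with multiplicities. -/
noncomputable def adjSpectrum {V : Type*} [Finite V] (Γ : SimpleGraph V) : Multiset ℂ :=
  letI : Fintype V := Fintype.ofFinite V
  (Γ.adjMatrix ℂ).charpoly.roots

/-- A finite graph is integral if its spectrum contains only integers. -/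
def IsIntegralGraph {V : Type*} [Finite V] (Γ : SimpleGraph V) : Prop :=
  ∀ z ∈ Γ.adjSpectrum, ∃ n : ℤ, z = (n : ℂ)

end SimpleGraph

/-- The commuting graph of a group: its vertices are the non-central elements, and two distinct
vertices are adjacent if and only if they commute. -/
def commutingGraph (G : Type*) [Group G] :
    SimpleGraph {x : G // x ∉ Subgroup.center G} where
  Adj x y := x ≠ y ∧ (x : G) * (y : G) = (y : G) * (x : G)
  symm := ⟨fun _ _ h => ⟨h.1.symm, h.2.symm⟩⟩
  loopless := ⟨fun _ h => h.1 rfl⟩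

/-! A planar graph contains no `K₃,₃`, so no two triples of group elements are such that every
element of one fails to commute with every element of the other. This forces commutation to be
transitive on non-central elements (`commute_of_commute_of_no_noncommuting_three_by_three`). Hence
the commuting graph is a disjoint union of cliques, and its spectrum is integral.

The exclusion of `K₃,₃` needs no Jordan curve theorem. For disjoint arcs `e`, `f` the map `(s, t) ↦
f t - e s` has a continuous logarithm, which gives integer relations between winding data; for the
nine arcs of `K₃,₃` these relations are inconsistent modulo 2. -/

/-! ### Continuous logarithms and the non-planarity of `K₃,₃` -/

open Complex in
theorem Complex.exists_continuous_exp_eq {A : Type*} [TopologicalSpace A] [SimplyConnectedSpace A]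
    [LocallyPathConnectedSpace A] {f : A → ℂ} (hf : Continuous f) (h0 : ∀ a, f a ≠ 0) :
    ∃ g : A → ℂ, Continuous g ∧ ∀ a, exp (g a) = f a := by
  obtain ⟨a₀⟩ : Nonempty A := inferInstance
  obtain ⟨F, ⟨-, hF⟩, -⟩ := Complex.isCoveringMapOn_exp.existsUnique_continuousMap_lifts
    (⟨f, hf⟩ : C(A, ℂ)) (a₀ := a₀) (e₀ := log (f a₀)) (exp_log (h0 a₀)) h0
  exact ⟨F, F.continuous, fun a => congrFun hF a⟩

theorem Complex.sub_eq_sub_of_exp_eq {A : Type*} [TopologicalSpace A] [SimplyConnectedSpace A]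
    [LocallyPathConnectedSpace A] {g g' : A → ℂ} (hg : Continuous g) (hg' : Continuous g')
    (h : ∀ a, exp (g a) = exp (g' a)) (a b : A) : g b - g a = g' b - g' a := by
  obtain ⟨F, -, hF⟩ := Complex.isCoveringMapOn_exp.existsUnique_continuousMap_lifts
    (⟨fun t => exp (g t), continuous_exp.comp hg⟩ : C(A, ℂ)) (a₀ := a) (e₀ := g a) rfl
    (fun t => exp_ne_zero _)
  have h1 := hF ⟨g, hg⟩ ⟨rfl, rfl⟩
  have h2 := hF ⟨fun t => g' t + (g a - g' a), by fun_prop⟩ ⟨by simp, by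
    funext t
    have : exp (g a - g' a) = 1 := by
      rw [exp_sub, h a, div_self (exp_ne_zero _)]
    simp [exp_add, this, h t]⟩
  have h3 := DFunLike.congr_fun (h1.trans h2.symm) b
  simp only [ContinuousMap.coe_mk] at h3
  rw [h3]; ring

open Classical in
/-- The total change of a continuous logarithm of `f` along `[0, 1]`. -/
noncomputable def logIncrement (f : ℝ → ℂ) : ℂ :=
  if h : ∃ g : ℝ → ℂ, Continuous g ∧ ∀ t, Complex.exp (g t) = f t then
    h.choose 1 - h.choose 0 else 0

theorem logIncrement_eq {f g : ℝ → ℂ} (hg : Continuous g) (h : ∀ t, Complex.exp (g t) = f t) :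
    logIncrement f = g 1 - g 0 := by
  have hex : ∃ g : ℝ → ℂ, Continuous g ∧ ∀ t, Complex.exp (g t) = f t := ⟨g, hg, h⟩
  rw [logIncrement, dif_pos hex]
  exact Complex.sub_eq_sub_of_exp_eq hex.choose_spec.1 hg
    (fun t => (hex.choose_spec.2 t).trans (h t).symm) 0 1

theorem exists_logIncrement_eq {f : ℝ → ℂ} (hf : Continuous f) (h0 : ∀ t, f t ≠ 0) {a b : ℂ}
    (ha : Complex.exp a = f 0) (hb : Complex.exp b = f 1) :
    ∃ n : ℤ, logIncrement f = b - a + n * (2 * Real.pi * Complex.I) := by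
  obtain ⟨g, hg, h⟩ := Complex.exists_continuous_exp_eq hf h0
  obtain ⟨m, hm⟩ := Complex.exp_eq_exp_iff_exists_int.1 ((h 0).trans ha.symm)
  obtain ⟨n, hn⟩ := Complex.exp_eq_exp_iff_exists_int.1 ((h 1).trans hb.symm)
  refine ⟨n - m, ?_⟩
  rw [logIncrement_eq hg h, hm, hn]
  push_cast; ring

/-- The vector from one to the other of two disjoint arcs does not wind around the boundary of the
parameter square. -/
theorem logIncrement_add_logIncrement_of_disjoint {e f : ℝ → ℂ} (he : Continuous e)
    (hf : Continuous f) (h : ∀ s t, e s ≠ f t) :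
    logIncrement (fun t => f t - e 0) + logIncrement (fun s => e s - f 1) =
      logIncrement (fun t => f t - e 1) + logIncrement (fun s => e s - f 0) := by
  obtain ⟨g, hg, hexp⟩ := Complex.exists_continuous_exp_eq
    (f := fun p : ℝ × ℝ => f p.2 - e p.1) (by fun_prop) (fun p => sub_ne_zero.2 (h _ _).symm)
  have h1 (s : ℝ) : logIncrement (fun t => f t - e s) = g (s, 1) - g (s, 0) :=
    logIncrement_eq (g := fun t => g (s, t)) (by fun_prop) (fun t => hexp (s, t))
  have h2 (t : ℝ) : logIncrement (fun s => e s - f t) = g (1, t) - g (0, t) := by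
    -- The vector `e s - f t` is the negative of `exp (g (s, t))`, hence the shift by `π * I`.
    rw [logIncrement_eq (g := fun s => g (s, t) + Real.pi * Complex.I) (by fun_prop)
      (fun s => by rw [Complex.exp_add, Complex.exp_pi_mul_I, hexp]; simp)]
    ring
  rw [h1, h1, h2, h2]; ring

/-- A logarithm of `y - x`, chosen so that the two orders of a pair differ by `π * I`. -/
noncomputable def pairLog {ι : Type*} [LinearOrder ι] (p : ι → ℂ) (i j : ι) : ℂ :=
  if i < j then Complex.log (p j - p i) else Complex.log (p i - p j) + Real.pi * Complex.I

theorem exp_pairLog {ι : Type*} [LinearOrder ι] {p : ι → ℂ} {i j : ι} (h : p i ≠ p j) :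
    Complex.exp (pairLog p i j) = p j - p i := by
  unfold pairLog
  split_ifs
  · exact Complex.exp_log (sub_ne_zero.2 h.symm)
  · rw [Complex.exp_add, Complex.exp_pi_mul_I, Complex.exp_log (sub_ne_zero.2 h)]; ring

theorem pairLog_swap {ι : Type*} [LinearOrder ι] (p : ι → ℂ) {i j : ι} (h : i < j) :
    pairLog p j i = pairLog p i j + Real.pi * Complex.I := by
  rw [pairLog, pairLog, if_pos h, if_neg h.not_gt]

/-- In any drawing of `K₃,₃` by continuous arcs some two arcs without a common end meet. -/
theorem exists_arcs_meet (p q : Fin 3 → ℂ) (γ : Fin 3 → Fin 3 → ℝ → ℂ)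
    (hγ : ∀ i j, Continuous (γ i j)) (h0 : ∀ i j, γ i j 0 = p i) (h1 : ∀ i j, γ i j 1 = q j) :
    ∃ i i' j j' s t, i ≠ i' ∧ j ≠ j' ∧ γ i j s = γ i' j' t := by
  by_contra! H
  have other (i : Fin 3) : ∃ j, i ≠ j := by revert i; decide
  have hpγ (i i' j t) (hi : i ≠ i') : γ i j t ≠ p i' := by
    obtain ⟨j', hj⟩ := other j
    rw [← h0 i' j']; exact H _ _ _ _ _ _ hi hj
  have hqγ (i j j' t) (hj : j ≠ j') : γ i j t ≠ q j' := by
    obtain ⟨i', hi⟩ := other i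
    rw [← h1 i' j']; exact H _ _ _ _ _ _ hi hj
  have hpp (i i') (hi : i ≠ i') : p i ≠ p i' := by rw [← h0 i 0]; exact hpγ _ _ _ _ hi
  have hqq (i i') (hi : i ≠ i') : q i ≠ q i' := by rw [← h1 0 i]; exact hqγ _ _ _ _ hi
  have hpq (i j) : p i ≠ q j := by
    obtain ⟨j', hj⟩ := other j
    rw [← h0 i j']; exact hqγ _ _ _ _ hj.symm
  -- The inequality sits inside the existential so that `choose` yields a total integer function.
  have N (i' i j) : ∃ n : ℤ, i ≠ i' → logIncrement (fun t => γ i j t - p i') =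
      Complex.log (q j - p i') - pairLog p i' i + n * (2 * Real.pi * Complex.I) := by
    by_cases hi : i = i'
    · exact ⟨0, fun h => (h hi).elim⟩
    · obtain ⟨n, hn⟩ := exists_logIncrement_eq (f := fun t => γ i j t - p i')
        (a := pairLog p i' i) (b := Complex.log (q j - p i')) ((hγ i j).sub continuous_const)
        (fun t => sub_ne_zero.2 (hpγ _ _ _ _ hi)) (by rw [exp_pairLog (hpp _ _ (Ne.symm hi)), h0])
        (by rw [Complex.exp_log (sub_ne_zero.2 (hpq _ _).symm), h1])
      exact ⟨n, fun _ => hn⟩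
  have M (j' i j) : ∃ n : ℤ, j ≠ j' → logIncrement (fun t => γ i j t - q j') =
      pairLog q j' j - (Complex.log (q j' - p i) + Real.pi * Complex.I) +
        n * (2 * Real.pi * Complex.I) := by
    by_cases hj : j = j'
    · exact ⟨0, fun h => (h hj).elim⟩
    · obtain ⟨n, hn⟩ := exists_logIncrement_eq (f := fun t => γ i j t - q j')
        (a := Complex.log (q j' - p i) + Real.pi * Complex.I) (b := pairLog q j' j)
        ((hγ i j).sub continuous_const)
        (fun t => sub_ne_zero.2 (hqγ _ _ _ _ hj))
        (by rw [Complex.exp_add, Complex.exp_pi_mul_I,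
              Complex.exp_log (sub_ne_zero.2 (hpq _ _).symm), h0]; ring)
        (by rw [exp_pairLog (hqq _ _ (Ne.symm hj)), h1])
      exact ⟨n, fun _ => hn⟩
  choose N hN using N
  choose M hM using M
  have pi0 : (2 * Real.pi * Complex.I : ℂ) ≠ 0 := Complex.two_pi_I_ne_zero
  -- The chosen logarithms cancel, except that the swaps in `pairLog` contribute `-1` exactly when
  -- `j < j'`.
  have key (i i' j j') (hi : i < i') (hj : j ≠ j') :
      N i i' j' + M j' i j = M j i' j' + N i' i j + if j < j' then -1 else 0 := by
    have h := logIncrement_add_logIncrement_of_disjoint (hγ i j) (hγ i' j')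
      (fun s t => H i i' j j' s t hi.ne hj)
    rw [h0, h0, h1, h1, hN _ _ _ hi.ne', hN _ _ _ hi.ne, hM _ _ _ hj, hM _ _ _ hj.symm,
      pairLog_swap p hi] at h
    rcases hj.lt_or_gt with hlt | hgt
    · rw [pairLog_swap q hlt] at h
      rw [if_pos hlt]
      refine Int.cast_injective (α := ℂ) (mul_right_cancel₀ pi0 ?_)
      push_cast
      linear_combination h
    · rw [pairLog_swap q hgt] at h
      rw [if_neg hgt.not_gt]
      refine Int.cast_injective (α := ℂ) (mul_right_cancel₀ pi0 ?_)
      push_cast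
      linear_combination h
  have k (i i') (hi : i < i') :
      N i i' 1 + M 1 i 0 = M 0 i' 1 + N i' i 0 + -1 ∧ N i i' 2 + M 2 i 0 = M 0 i' 2 + N i' i 0 + -1 ∧
      N i i' 2 + M 2 i 1 = M 1 i' 2 + N i' i 1 + -1 ∧ N i i' 0 + M 0 i 1 = M 1 i' 0 + N i' i 1 ∧
      N i i' 0 + M 0 i 2 = M 2 i' 0 + N i' i 2 ∧ N i i' 1 + M 1 i 2 = M 2 i' 1 + N i' i 2 := by
    refine ⟨?_, ?_, ?_, ?_, ?_, ?_⟩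
    · simpa using key i i' 0 1 hi (by decide)
    · simpa using key i i' 0 2 hi (by decide)
    · simpa using key i i' 1 2 hi (by decide)
    · simpa using key i i' 1 0 hi (by decide)
    · simpa using key i i' 2 0 hi (by decide)
    · simpa using key i i' 2 1 hi (by decide)
  have k01 := k 0 1 (by decide)
  have k02 := k 0 2 (by decide)
  have k12 := k 1 2 (by decide)
  -- Weight the relation for `(j, j')` by `1` if `j' = j + 1` modulo 3 and by `-1` otherwise. The
  -- `N` terms cancel, leaving `S i + S i' = -1` with `S i` the weighted sum of `M j' i j`. Adding
  -- over the three pairs gives `2 * (S 0 + S 1 + S 2) = -3`.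
  omega

/-! ### Planar graphs and unions of cliques -/

namespace SimpleGraph

theorem PlaneEmbedding.arc_disjoint {V : Type*} {Γ : SimpleGraph V} (P : Γ.PlaneEmbedding)
    {d d' : Γ.Dart} (h₁ : d.fst ≠ d'.fst) (h₂ : d.fst ≠ d'.snd) (h₃ : d.snd ≠ d'.fst)
    (h₄ : d.snd ≠ d'.snd) (s t : unitInterval) : P.arc d s ≠ P.arc d' t := by
  have hedge : d.edge ≠ d'.edge := by
    rw [Ne, dart_edge_eq_iff]
    rintro (rfl | rfl)
    · exact h₁ rfl
    · exact h₂ rfl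
  have cases (u : unitInterval) : u = 0 ∨ u = 1 ∨ (0 < u ∧ u < 1) := by
    rcases eq_or_ne u 0 with h | h
    · exact .inl h
    rcases eq_or_ne u 1 with h' | h'
    · exact .inr (.inl h')
    · exact .inr (.inr ⟨unitInterval.pos_iff_ne_zero.2 h, unitInterval.lt_one_iff_ne_one.2 h'⟩)
  have inj := P.point_injective
  rcases cases s with rfl | rfl | ⟨hs, hs'⟩ <;> rcases cases t with rfl | rfl | ⟨ht, ht'⟩ <;>
    try simp only [Path.source, Path.target]
  · exact inj.ne h₁
  · exact inj.ne h₂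
  · exact (P.arc_ne_point _ _ _ ht ht').symm
  · exact inj.ne h₃
  · exact inj.ne h₄
  · exact (P.arc_ne_point _ _ _ ht ht').symm
  · exact P.arc_ne_point _ _ _ hs hs'
  · exact P.arc_ne_point _ _ _ hs hs'
  · exact P.arc_ne_arc _ _ _ _ hedge hs hs' ht ht'

/-- A planar graph does not contain `K₃,₃`. -/
theorem IsPlanarGraph.not_forall_adj {V : Type*} {Γ : SimpleGraph V} (h : Γ.IsPlanarGraph)
    {a b : Fin 3 → V} (ha : Function.Injective a) (hb : Function.Injective b) :
    ¬ ∀ i j, Γ.Adj (a i) (b j) := by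
  intro hab
  obtain ⟨P⟩ := h
  let Φ : ℂ ≃ₗᵢ[ℝ] EuclideanSpace ℝ (Fin 2) := Complex.orthonormalBasisOneI.repr
  let d (i j : Fin 3) : Γ.Dart := ⟨(a i, b j), hab i j⟩
  obtain ⟨i, i', j, j', s, t, hi, hj, heq⟩ := exists_arcs_meet
    (fun i => Φ.symm (P.point (a i))) (fun j => Φ.symm (P.point (b j)))
    (fun i j t => Φ.symm (P.arc (d i j) (Set.projIcc 0 1 zero_le_one t)))
    (fun i j => Φ.symm.continuous.comp ((P.arc (d i j)).continuous.comp continuous_projIcc))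
    (fun i j => by
      have : Set.projIcc (0 : ℝ) 1 zero_le_one 0 = 0 := Set.projIcc_left _
      simp only [this, Path.source]; rfl)
    (fun i j => by
      have : Set.projIcc (0 : ℝ) 1 zero_le_one 1 = 1 := Set.projIcc_right _
      simp only [this, Path.target]; rfl)
  exact P.arc_disjoint (d := d i j) (d' := d i' j') (ha.ne hi) (hab i j').ne (hab i' j).ne'
    (hb.ne hj) _ _ (Φ.symm.injective heq)

/-- A graph in which adjacency is transitive, that is, a disjoint union of cliques, is integral. -/
theorem isIntegralGraph_of_adj_trans {V : Type*} [Finite V] {Γ : SimpleGraph V}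
    (h : ∀ x y z, Γ.Adj x y → Γ.Adj y z → x ≠ z → Γ.Adj x z) : Γ.IsIntegralGraph := by
  classical
  intro c hc
  unfold adjSpectrum at hc
  let : Fintype V := Fintype.ofFinite V
  have hc := Polynomial.isRoot_of_mem_roots hc
  rw [← Matrix.mem_spectrum_iff_isRoot_charpoly, ← Matrix.spectrum_toLin',
    ← Module.End.hasEigenvalue_iff_mem_spectrum] at hc
  obtain ⟨v, hv⟩ := hc.exists_hasEigenvector
  -- Adjacent vertices have the same closed neighbourhood, so an eigenvector with `c ≠ -1` is
  -- constant on each clique and `c + 1` is a clique size.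
  have hsum (x : V) : ∑ y ∈ insert x (Γ.neighborFinset x), v y = (c + 1) * v x := by
    have := congrFun hv.apply_eq_smul x
    rw [Matrix.toLin'_apply] at this
    erw [adjMatrix_mulVec_apply] at this
    rw [Finset.sum_insert (by simp)]
    simp only [Pi.smul_apply, smul_eq_mul] at this
    rw [add_mul, one_mul, ← this, add_comm]
  by_cases hc1 : c = -1
  · exact ⟨-1, by simp [hc1]⟩
  have hc1 : c + 1 ≠ 0 := fun h => hc1 (eq_neg_of_add_eq_zero_left h)
  have hconst (x y : V) (hxy : Γ.Adj x y) : v y = v x := by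
    refine mul_left_cancel₀ hc1 ?_
    rw [← hsum, ← hsum]
    congr 1
    ext z
    simp only [Finset.mem_insert, mem_neighborFinset]
    constructor
    · rintro (rfl | hz)
      · exact .inr hxy
      · by_cases hxz : x = z
        · exact .inl hxz.symm
        · exact .inr (h _ _ _ hxy hz hxz)
    · rintro (rfl | hz)
      · exact .inr hxy.symm
      · by_cases hyz : y = z
        · exact .inl hyz.symm
        · exact .inr (h _ _ _ hxy.symm hz hyz)
  obtain ⟨x, hx⟩ := Function.ne_iff.1 hv.2
  have hx' := hsum x
  rw [Finset.sum_congr rfl (g := fun _ => v x) (fun y hy => by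
    rcases Finset.mem_insert.1 hy with rfl | hy
    · rfl
    · exact hconst _ _ ((mem_neighborFinset _ _ _).1 hy)), Finset.sum_const, nsmul_eq_mul] at hx'
  have := mul_right_cancel₀ hx hx'
  exact ⟨(insert x (Γ.neighborFinset x)).card - 1, by push_cast; rw [this]; ring⟩

end SimpleGraph

/-! ### Centralizers in the group -/

/-- A subgroup of index 2 is normal, so conjugation preserves the centre of the centralizer. If that
centre is contained in `{1, x}`, every conjugate of `x` is `x`. -/
theorem Subgroup.centralizer_singleton_index_ne_two {G : Type*} [Group G] {x : G} (hx1 : x ≠ 1)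
    (hx : x ∉ center G)
    (h : ∀ c, (∀ g, Commute g x → Commute c g) → c = 1 ∨ c = x) :
    (centralizer {x}).index ≠ 2 := by
  intro hi
  have hn := normal_of_index_eq_two hi
  have hmem (g : G) : g ∈ centralizer {x} ↔ Commute g x := by
    rw [mem_centralizer_singleton_iff]; exact Iff.rfl
  refine hx (mem_center_iff.2 fun g => ?_)
  have hc (k : G) (hk : Commute k x) : Commute (g * x * g⁻¹) k := by
    have hk' := (hmem _).1 (hn.conj_mem k ((hmem k).2 hk) g⁻¹)
    rw [← Commute.conj_iff g] at hk'
    simpa [mul_assoc] using hk'.symm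
  rcases h _ hc with h1 | h1
  · exact (hx1 (by simpa using h1)).elim
  · rwa [mul_inv_eq_iff_eq_mul] at h1

/-- If `y` and `z` do not commute, the centre of the centralizer `C` of `x` is only `{1, x}`, and
`C` has index at least 3. So many elements lie outside `C`, and three of them commute with none of
`x`, `y'`, `z'`, for some `y' ∈ {y, y * x}` and `z' ∈ {z, z * x}`. -/
theorem commute_of_commute_of_no_noncommuting_three_by_three {G : Type*} [Group G] [Finite G]
    (hK : ∀ s t : Finset G, 3 ≤ s.card → 3 ≤ t.card → ¬ ∀ x ∈ s, ∀ y ∈ t, ¬ Commute x y)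
    {x y z : G} (hx : x ∉ Subgroup.center G) (hyx : Commute y x) (hzx : Commute z x) :
    Commute y z := by
  classical
  have := Fintype.ofFinite G
  by_contra hyz
  have hx1 : x ≠ 1 := fun h => hx (h ▸ Subgroup.one_mem _)
  have hZ (c : G) (hc : ∀ g, Commute g x → Commute c g) : c = 1 ∨ c = x := by
    -- A third central element `c` of the centralizer would make `y * {1, x, c}` and `z * {1, x, c}`
    -- a forbidden pair of triples.
    by_contra! hne
    have hcard (w : G) : 3 ≤ (Finset.image (w * ·) {1, x, c}).card := by
      rw [Finset.card_image_of_injective _ (mul_right_injective w),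
        Finset.card_eq_three.2 ⟨1, x, c, hx1.symm, hne.1.symm, hne.2.symm, rfl⟩]
    refine hK _ _ (hcard y) (hcard z) ?_
    have hA (a : G) (ha : a ∈ ({1, x, c} : Finset G)) (g : G) (hg : Commute g x) :
        Commute a g := by
      simp only [Finset.mem_insert, Finset.mem_singleton] at ha
      rcases ha with rfl | rfl | rfl
      · exact Commute.one_left _
      · exact hg.symm
      · exact hc g hg
    intro p hp q hq hpq
    obtain ⟨a, ha, rfl⟩ := Finset.mem_image.1 hp
    obtain ⟨b, hb, rfl⟩ := Finset.mem_image.1 hq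
    have hbx : Commute b x := hA b hb x (Commute.refl x)
    have h1 : Commute (y * a * a⁻¹) (z * b) :=
      Commute.mul_left hpq (hA a ha _ (hzx.mul_left hbx)).inv_left
    rw [mul_inv_cancel_right] at h1
    have h2 : Commute y (z * b * b⁻¹) := h1.mul_right (hA b hb y hyx).symm.inv_right
    rw [mul_inv_cancel_right] at h2
    exact hyz h2
  let C := Subgroup.centralizer {x}
  have hmem (g : G) : g ∈ C ↔ Commute g x := by
    rw [Subgroup.mem_centralizer_singleton_iff]; exact Iff.rfl
  have hindex : 3 ≤ C.index := by
    have h0 : C.index ≠ 0 := Subgroup.index_ne_zero_of_finite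
    have h1 : C.index ≠ 1 := fun h => hx <| Subgroup.mem_center_iff.2 fun g =>
      (hmem g).1 (Subgroup.index_eq_one.1 h ▸ Subgroup.mem_top g)
    have h2 : C.index ≠ 2 := Subgroup.centralizer_singleton_index_ne_two hx1 hx hZ
    omega
  have hC : 5 ≤ Nat.card C := by
    have hsub : ({1, x, y, y * x, z} : Finset G) ⊆ Finset.univ.filter (· ∈ C) := by
      intro g hg
      simp only [Finset.mem_insert, Finset.mem_singleton] at hg
      simp only [Finset.mem_filter, Finset.mem_univ, true_and, hmem]
      rcases hg with rfl | rfl | rfl | rfl | rfl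
      exacts [Commute.one_left _, Commute.refl _, hyx, hyx.mul_left (Commute.refl _), hzx]
    have hy1 : y ≠ 1 := by rintro rfl; exact hyz (Commute.one_left _)
    have hz1 : z ≠ 1 := by rintro rfl; exact hyz (Commute.one_right _)
    have hyx' : y ≠ x := by rintro rfl; exact hyz hzx.symm
    have hzx' : z ≠ x := by rintro rfl; exact hyz hyx
    have hzy : z ≠ y := by rintro rfl; exact hyz (Commute.refl _)
    have hzyx : z ≠ y * x := by rintro rfl; exact hyz ((Commute.refl _).mul_right hyx)
    have hyx1 : y * x ≠ 1 := fun h => by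
      rw [eq_inv_of_mul_eq_one_left h] at hyz
      exact hyz hzx.symm.inv_left
    have hcard : ({1, x, y, y * x, z} : Finset G).card = 5 := by
      repeat rw [Finset.card_insert_of_notMem]
      · simp
      all_goals
        simp only [Finset.mem_insert, Finset.mem_singleton, not_or]
        simp [hy1, hx1, hy1.symm, hz1.symm, hyx'.symm,
          hzx'.symm, hzy.symm, hzyx.symm, hyx1.symm, hx1.symm]
    calc 5 = _ := hcard.symm
      _ ≤ _ := Finset.card_le_card hsub
      _ = Nat.card C := by rw [Nat.card_eq_fintype_card, Fintype.card_subtype]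
  let W : Finset G := Finset.univ.filter fun w => ¬ Commute w x
  have hW : 9 ≤ W.card := by
    have h1 := Finset.card_filter_add_card_filter_not (s := (Finset.univ : Finset G))
      (fun w => Commute w x)
    have h2 : (Finset.univ.filter fun w => Commute w x).card = Nat.card C := by
      rw [Nat.card_eq_fintype_card, Fintype.card_subtype]; simp only [hmem]
    have h3 := C.card_mul_index
    rw [Nat.card_eq_fintype_card (α := G), ← Finset.card_univ] at h3
    have h4 := Nat.mul_le_mul_left (Nat.card C) hindex
    change _ + W.card = _ at h1
    omega
  -- Nine elements in four classes put three in one class.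
  obtain ⟨⟨u, v⟩, -, hcard⟩ := Finset.exists_lt_card_fiber_of_mul_lt_card_of_maps_to
    (s := W) (t := (Finset.univ : Finset (Bool × Bool))) (n := 2)
    (f := fun w => (decide (Commute w y), decide (Commute w z))) (fun _ _ => Finset.mem_univ _)
    (by simp only [Finset.card_univ, Fintype.card_prod, Fintype.card_bool]; omega)
  -- An element commuting with both `r` and `r * x` would commute with `x`.
  have hpick (r : G) (hr : Commute r x) (u : Bool) : ∃ r', (r' = r ∨ r' = r * x) ∧
      ∀ w, ¬ Commute w x → decide (Commute w r) = u → ¬ Commute w r' := by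
    cases u
    · exact ⟨r, .inl rfl, fun w _ hw => of_decide_eq_false hw⟩
    · refine ⟨r * x, .inr rfl, fun w hwx hw hwr => hwx ?_⟩
      have := ((of_decide_eq_true hw).inv_right).mul_right hwr
      rwa [inv_mul_cancel_left] at this
  obtain ⟨y', hy', hWy⟩ := hpick y hyx u
  obtain ⟨z', hz', hWz⟩ := hpick z hzx v
  have hyx' : Commute y' x := by
    rcases hy' with rfl | rfl
    exacts [hyx, hyx.mul_left (Commute.refl _)]
  have hzx' : Commute z' x := by
    rcases hz' with rfl | rfl
    exacts [hzx, hzx.mul_left (Commute.refl _)]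
  have hyz' : ¬ Commute y' z' := by
    intro h
    have h1 : Commute y z' := by
      rcases hy' with rfl | rfl
      · exact h
      · simpa using h.mul_left hzx'.symm.inv_left
    rcases hz' with rfl | rfl
    · exact hyz h1
    · exact hyz (by simpa using h1.mul_right hyx.inv_right)
  refine hK _ {x, y', z'} hcard (Finset.card_eq_three.2 ⟨x, y', z', ?_, ?_, ?_, rfl⟩).ge ?_
  · rintro rfl; exact hyz' hzx'.symm
  · rintro rfl; exact hyz' hyx'
  · rintro rfl; exact hyz' (Commute.refl _)
  · intro w hw r hr
    simp only [W, Finset.mem_filter, Finset.mem_univ, true_and, Prod.mk.injEq] at hw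
    simp only [Finset.mem_insert, Finset.mem_singleton] at hr
    rcases hr with rfl | rfl | rfl
    exacts [hw.1, hWy _ hw.1 hw.2.1, hWz _ hw.1 hw.2.2]

theorem not_forall_not_commute_of_isPlanarGraph {G : Type*} [Group G]
    (h : (commutingGraph G)ᶜ.IsPlanarGraph) {s t : Finset G} (hs : 3 ≤ s.card) (ht : 3 ≤ t.card) :
    ¬ ∀ x ∈ s, ∀ y ∈ t, ¬ Commute x y := by
  intro hst
  let a (i : Fin 3) : s := s.equivFin.symm (Fin.castLE hs i)
  let b (i : Fin 3) : t := t.equivFin.symm (Fin.castLE ht i)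
  have ha : Function.Injective a := s.equivFin.symm.injective.comp (Fin.castLE_injective hs)
  have hb : Function.Injective b := t.equivFin.symm.injective.comp (Fin.castLE_injective ht)
  have hab (i j) : ¬ Commute (a i : G) (b j) := hst _ (a i).2 _ (b j).2
  refine h.not_forall_adj
    (a := fun i => ⟨a i, fun hc => hab i 0 (Subgroup.mem_center_iff.1 hc _).symm⟩)
    (b := fun j => ⟨b j, fun hc => hab 0 j (Subgroup.mem_center_iff.1 hc _)⟩)
    (fun i j hij => ha (Subtype.ext (Subtype.mk.inj hij)))
    (fun i j hij => hb (Subtype.ext (Subtype.mk.inj hij))) fun i j => ?_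
  rw [SimpleGraph.compl_adj]
  refine ⟨fun hij => hab i j ?_, fun hij => hab i j hij.2⟩
  rw [congrArg Subtype.val hij]

theorem proposition3p9 (G : Type*) [Group G] [Finite G]
    (hG : ¬ ∀ x y : G, x * y = y * x)
    (hplanar : (commutingGraph G)ᶜ.IsPlanarGraph) :
    (commutingGraph G).IsIntegralGraph := by
  refine SimpleGraph.isIntegralGraph_of_adj_trans fun x y z hxy hyz hxz => ⟨hxz, ?_⟩
  exact commute_of_commute_of_no_noncommuting_three_by_three
    (fun _ _ => not_forall_not_commute_of_isPlanarGraph hplanar) y.2 hxy.2 hyz.2.symm
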